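/- **Setting.** Let $N\ge 1$ and $M$ be integers, let $\mathcal X_1,\dots,\mathcal X_N$ be nonempty sets, let $\mathcal E_1,\dots,\mathcal E_M$ be real separable Hilbert spaces, and let $\mathcal E=\prod_{j=1}^M\mathcal E_j$ be their Hilbert product, of dimension $q\in\{0,1,2,\dots\}\cup\{+\infty\}$. Let $g_{ij}:\mathcal X_i\to\mathcal E_j$ and $f_j:\mathcal E_j\to\mathbb R$, and put $g_i=(g_{ij})_{j}$, $f(y)=\sum_{j=1}^M f_j(y_j)$ for $y \in \mathcal E$, $\mathcal X=\prod_{i=1}^N\mathcal X_i$, $G(x)=\frac1N\sum_{i=1}^N g_i(x_i)$ and $J(x)=f(G(x))$ for $x\in\mathcal X$, $S_{ij}=g_{ij}(\mathcal X_i)$ and $S_j=\frac1N\sum_{i=1}^N S_{ij}$ (Minkowski sum). For a set $\Omega$, let $\mathcal P_\delta(\Omega)$ be the set of finitely supported probability distributions on $\Omega$; for $\mu=\sum_k t_k\delta_{x_k}\in\mathcal P_\delta(\Omega)$ and a map $F$ from $\Omega$ to a Hilbert space, let $E_\mu[F]=\sum_k t_kF(x_k)$ and $\sigma^2_\mu[F]=\sum_k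 t_k\|F(x_k)-E_\mu[F]\|^2$. Let $$J^*=\inf_{x\in\mathcal X}J(x),\qquad \mathcal J^*=\inf_{\mu\in\prod_{i}\mathcal P_\delta(\mathcal X_i)} f\Big(\frac1N\sum_{i=1}^N E_{\mu_i}[g_i]\Big).$$ Let $L_j\ge 0$ and $\tilde L_j>0$ be constants, and put $\tilde g_i=(\sqrt{\tilde L_j}\,g_{ij})_{j}$, $\tilde f(y)=\sum_{j=1}^M f_j(y_j/\sqrt{\tilde L_j})$, $\mathcal Y_i=\tilde g_i(\mathcal X_i)$ and $\mathcal Y=\frac1N\sum_{i=1}^N\mathcal Y_i$. For $\lambda\in\mathcal E$ let $$\Phi_i(\lambda)=\inf_{x_i\in\mathcal X_i}\langle\lambda,\tilde g_i(x_i)\rangle,\qquad \mathcal X_i(\lambda)=\operatorname*{argmin}_{x_i\in\mathcal X_i}\langle\lambda,\tilde g_i(x_i)\rangle,\qquad \mathcal Y_i(\lambda)=\operatorname*{argmin}_{y_i\in\mathcal Y_i}\langle\lambda,y_i\rangle,$$ and let $\tilde f^*(\lambda)=\sup_{y\in\mathcal E}\big(\langle\lambda,y\rangle-\tilde f(y)\big)$.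 The dual problem is $$\sup_{\lambda\in\mathcal E}\Big(-\tilde f^*(\lambda)+\frac1N\sum_{i=1}^N\Phi_i(\lambda)\Big).$$ The nonconvexity measure of a bounded set $\mathcal K\subseteq\mathcal E$ is $$\rho(\mathcal K)=\Big(\sup_{y\in\mathrm{conv}(\mathcal K)}\ \inf\big\{\sigma^2_\mu[\mathrm{Id}] : \mu\in\mathcal P_\delta(\mathcal K),\ E_\mu[\mathrm{Id}]=y\big\}\Big)^{1/2}.$$ **Assumptions.** 1. For all $i,j$: $S_{ij}$ has finite diameter; $f_j$ is $L_j$-Lipschitz on $\mathrm{conv}(S_j)$; $f_j$ is continuously differentiable on a neighborhood of $\mathrm{conv}(S_j)$ and $\nabla f_j$ is $\tilde L_j$-Lipschitz on $\mathrm{conv}(S_j)$. 2. Every $f_j$ is convex and lower semicontinuous on $\mathcal E_j$. 3. For all $i$ and all $y\in\mathrm{conv}(G(\mathcal X))$, the problem $\inf_{x_i\in\mathcal X_i}\langle\nabla f(y),g_i(x_i)\rangle$ has a solution. 4. $\mathrm{conv}(\mathcal Y)$ is closed. **Proposition.** Under these assumptions, let $\lambda$ be a solution of the dual problem, let $J_{\mathrm{dec}}$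 be the infimum of $J(x)$ over the $x\in\mathcal X$ with $x_i\in\mathcal X_i(\lambda)$ for all $i$, and let $p=J_{\mathrm{dec}}-J^*$ be the price of decentralization. Then $J^*$, $\mathcal J^*$ and $J_{\mathrm{dec}}$ are finite (in particular the problem defining $J_{\mathrm{dec}}$ is feasible), and $$p\ \le\ J_{\mathrm{dec}}-\mathcal J^*\ \le\ \frac1{2N^2}\ \max_{\substack{Q\subseteq\{1,\dots,N\}\\ |Q|=q\wedge N}}\ \sum_{i\in Q}\rho\big(\mathcal Y_i(\lambda)\big)^2 .$$ -/

import Mathlib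

open scoped NNReal Pointwise

noncomputable section

/-! ### Finitely supported probability distributions and the nonconvexity measure -/

/-- Finitely supported probability distributions on `Ω`: finitely many nonnegative weights
summing to one, i.e. the convex combinations of Dirac masses. -/
abbrev FinProb (Ω : Type*) : Type _ := Convexity.StdSimplex ℝ Ω

/-- `E_μ[F] = ∑ₖ μ(xₖ) F(xₖ)`. -/
def FinProb.expect {Ω H : Type*} [AddCommGroup H] [Module ℝ H]
    (μ : FinProb Ω) (F : Ω → H) : H :=
  μ.weights.sum fun x r => r • F x

/-- `σ²_μ[F] = ∑ₖ μ(xₖ) ‖F(xₖ) - E_μ[F]‖²`. -/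
def FinProb.variance {Ω H : Type*} [NormedAddCommGroup H] [NormedSpace ℝ H]
    (μ : FinProb Ω) (F : Ω → H) : ℝ :=
  μ.weights.sum fun x r => r * ‖F x - FinProb.expect μ F‖ ^ 2

/-- The nonconvexity measure `ρ(K)` of a (bounded) set `K`: the square root of the supremum over
`y ∈ conv K` of the smallest variance of a finitely supported probability distribution on `K`
with mean `y`. -/
def nonconvexityMeasure {H : Type*} [NormedAddCommGroup H] [NormedSpace ℝ H] (K : Set H) : ℝ :=
  Real.sqrt (⨆ y : convexHull ℝ K,
    ⨅ μ : {μ : FinProb K // FinProb.expect μ (fun k => (k : H)) = (y : H)},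
      FinProb.variance μ.1 (fun k => (k : H)))

/-- The Fenchel conjugate of a real-valued function on a Hilbert space, as an extended real. -/
def fenchelConjugate {H : Type*} [NormedAddCommGroup H] [InnerProductSpace ℝ H]
    (F : H → ℝ) (p : H) : EReal :=
  ⨆ y : H, ((inner ℝ p y - F y : ℝ) : EReal)

/-! ### The aggregative problem -/

/-- The data of an aggregative problem with `N` agents, decision sets `X i` and aggregate space
`∏ j, E j`: the contribution maps `g i j : X i → E j`, the cost functions `f j : E j → ℝ`, and
the numbers `L j`, `Lt j` used as Lipschitz moduli of `f j` and of its gradient. -/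
structure AggregativeProblem {N M : ℕ} (X : Fin N → Type*) (E : Fin M → Type*) where
  g : ∀ (i : Fin N) (j : Fin M), X i → E j
  f : ∀ j : Fin M, E j → ℝ
  L : Fin M → ℝ≥0
  Lt : Fin M → ℝ≥0

namespace AggregativeProblem

variable {N M : ℕ} {X : Fin N → Type*} {E : Fin M → Type*}
  [∀ j, NormedAddCommGroup (E j)] [∀ j, InnerProductSpace ℝ (E j)]

/-- `S_{ij}`, the range of `g_{ij}`. -/
def rangeSet (P : AggregativeProblem X E) (i : Fin N) (j : Fin M) : Set (E j) :=
  Set.range (P.g i j)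

/-- `S_j = (1/N) ∑ᵢ S_{ij}` (Minkowski sum). -/
def meanRangeSet (P : AggregativeProblem X E) (j : Fin M) : Set (E j) :=
  (N : ℝ)⁻¹ • ∑ i, P.rangeSet i j

/-- The function `f(y) = ∑ⱼ f_j(y_j)` on the Hilbert product of the spaces `E j`. -/
def cost (P : AggregativeProblem X E) (y : PiLp 2 E) : ℝ :=
  ∑ j, P.f j (y j)

/-- The contribution map `g_i = (g_{ij})_j`. -/
def contribution (P : AggregativeProblem X E) (i : Fin N) (x : X i) : PiLp 2 E :=
  WithLp.toLp 2 fun j => P.g i j x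

/-- The aggregate `G(x) = (1/N) ∑ᵢ g_i(x_i)`. -/
def aggregate (P : AggregativeProblem X E) (x : ∀ i, X i) : PiLp 2 E :=
  (N : ℝ)⁻¹ • ∑ i, P.contribution i (x i)

/-- The criterion `J(x) = f(G(x))`. -/
def J (P : AggregativeProblem X E) (x : ∀ i, X i) : ℝ :=
  P.cost (P.aggregate x)

/-- The randomized criterion `𝒥(μ) = f((1/N) ∑ᵢ E_{μᵢ}[g_i])`. -/
def Jrand (P : AggregativeProblem X E) (μ : ∀ i, FinProb (X i)) : ℝ :=
  P.cost ((N : ℝ)⁻¹ • ∑ i, FinProb.expect (μ i) (P.contribution i))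

/-- `J*`, the value of the original problem. -/
def primalValue (P : AggregativeProblem X E) : ℝ :=
  sInf (Set.range P.J)

/-- `𝒥*`, the value of the randomized problem. -/
def randomizedValue (P : AggregativeProblem X E) : ℝ :=
  sInf (Set.range P.Jrand)

/-- The rescaled contributions `g̃_i = (√L̃_j g_{ij})_j`. -/
def scaledContribution (P : AggregativeProblem X E) (i : Fin N) (x : X i) : PiLp 2 E :=
  WithLp.toLp 2 fun j => Real.sqrt (P.Lt j) • P.g i j x

/-- The rescaled function `f̃(y) = ∑ⱼ f_j(y_j / √L̃_j)`. -/
def scaledCost (P : AggregativeProblem X E) (y : PiLp 2 E) : ℝ :=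
  ∑ j, P.f j ((Real.sqrt (P.Lt j))⁻¹ • y j)

/-- `𝒴_i = g̃_i(X_i)`. -/
def agentSet (P : AggregativeProblem X E) (i : Fin N) : Set (PiLp 2 E) :=
  Set.range (P.scaledContribution i)

/-- `𝒴 = (1/N) ∑ᵢ 𝒴_i` (Minkowski sum). -/
def aggregateSet (P : AggregativeProblem X E) : Set (PiLp 2 E) :=
  (N : ℝ)⁻¹ • ∑ i, P.agentSet i

/-- `Φ_i(λ) = inf_{x ∈ X_i} ⟨λ, g̃_i(x)⟩`. -/
def Phi (P : AggregativeProblem X E) (i : Fin N) (lam : PiLp 2 E) : ℝ :=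
  ⨅ x : X i, inner ℝ lam (P.scaledContribution i x)

/-- `𝒳_i(λ)`, the minimizers of `⟨λ, g̃_i(·)⟩` over `X_i`. -/
def bestResponse (P : AggregativeProblem X E) (lam : PiLp 2 E) (i : Fin N) : Set (X i) :=
  {x | ∀ x' : X i,
    inner ℝ lam (P.scaledContribution i x) ≤ inner ℝ lam (P.scaledContribution i x')}

/-- `𝒴_i(λ)`, the minimizers of `⟨λ, ·⟩` over `𝒴_i`. -/
def bestResponseSet (P : AggregativeProblem X E) (lam : PiLp 2 E) (i : Fin N) :
    Set (PiLp 2 E) :=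
  {y | y ∈ P.agentSet i ∧ ∀ y' ∈ P.agentSet i, inner ℝ lam y ≤ inner ℝ lam y'}

/-- The dual criterion `-f̃*(λ) + (1/N) ∑ᵢ Φ_i(λ)`. -/
def dualObjective (P : AggregativeProblem X E) (lam : PiLp 2 E) : EReal :=
  -fenchelConjugate P.scaledCost lam + (((N : ℝ)⁻¹ * ∑ i, P.Phi i lam : ℝ) : EReal)

/-- `λ` is a solution of the dual problem. -/
def IsDualSolution (P : AggregativeProblem X E) (lam : PiLp 2 E) : Prop :=
  ∀ lam' : PiLp 2 E, P.dualObjective lam' ≤ P.dualObjective lam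

/-- The decision profiles all of whose components are best responses to `λ`. -/
def decFeasible (P : AggregativeProblem X E) (lam : PiLp 2 E) : Set (∀ i, X i) :=
  {x | ∀ i, x i ∈ P.bestResponse lam i}

/-- `J_dec`, the value of the problem restricted to best responses to `λ`. -/
def decValue (P : AggregativeProblem X E) (lam : PiLp 2 E) : ℝ :=
  sInf (P.J '' P.decFeasible lam)

/-- The price of decentralization `p = J_dec - J*`. -/
def priceOfDecentralization (P : AggregativeProblem X E) (lam : PiLp 2 E) : ℝ :=
  P.decValue lam - P.primalValue

/-- The dimension `q` of the aggregate space, possibly infinite. -/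
def aggregateDim (_P : AggregativeProblem X E) : ℕ∞ :=
  Cardinal.toENat (Module.rank ℝ (PiLp 2 E))

/-- `q ∧ N`, as a natural number. -/
def dimMin (P : AggregativeProblem X E) : ℕ :=
  (min P.aggregateDim (N : ℕ∞)).toNat

/-- `max_{|Q| = q ∧ N} ∑_{i ∈ Q} ρ(𝒴_i(λ))²`, over the (finitely many) subsets `Q` of the agents
with `q ∧ N` elements. -/
def maxBestResponseNonconvexity (P : AggregativeProblem X E) (lam : PiLp 2 E) : ℝ :=
  ⨆ Q : {Q : Finset (Fin N) // Q.card = P.dimMin},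
    ∑ i ∈ Q.1, nonconvexityMeasure (P.bestResponseSet lam i) ^ 2

/-- Standing regularity assumptions: the ranges `S_{ij}` have finite diameter, `f_j` is
`L_j`-Lipschitz on `conv S_j` and continuously differentiable near `conv S_j`, and its gradient
is `L̃_j`-Lipschitz on `conv S_j`. -/
structure Regular [∀ j, CompleteSpace (E j)] (P : AggregativeProblem X E) : Prop where
  bounded : ∀ i j, Bornology.IsBounded (P.rangeSet i j)
  lipschitz : ∀ j, LipschitzOnWith (P.L j) (P.f j) (convexHull ℝ (P.meanRangeSet j))
  contDiff : ∀ j, ∃ U : Set (E j), IsOpen U ∧ convexHull ℝ (P.meanRangeSet j) ⊆ U ∧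
    ContDiffOn ℝ 1 (P.f j) U
  lipschitz_gradient : ∀ j,
    LipschitzOnWith (P.Lt j) (gradient (P.f j)) (convexHull ℝ (P.meanRangeSet j))

/-- Each `f_j` is lower semicontinuous and convex. -/
structure ConvexCost (P : AggregativeProblem X E) : Prop where
  lsc : ∀ j, LowerSemicontinuous (P.f j)
  convex : ∀ j, ConvexOn ℝ Set.univ (P.f j)

/-- For every `y ∈ conv G(X)`, each linearized problem `inf_{x ∈ X_i} ⟨∇f(y), g_i(x)⟩` has a
solution. -/
def OracleSolvable [∀ j, CompleteSpace (E j)] (P : AggregativeProblem X E) : Prop :=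
  ∀ i, ∀ y ∈ convexHull ℝ (Set.range P.aggregate), ∃ x : X i, ∀ x' : X i,
    inner ℝ (gradient P.cost y) (P.contribution i x) ≤
      inner ℝ (gradient P.cost y) (P.contribution i x')

end AggregativeProblem

end

/-!
# The price of decentralization in convex aggregative problems

Write `F` for the rescaled cost and `K` for the convex hull of the rescaled aggregate set. `K` is
closed, convex and bounded, and `F` is convex and lower semicontinuous, so `F` has a minimizer `y`
on `K`. Every randomized profile has its rescaled mean in `K`, so `F y` bounds the randomized
value, and hence the original one, from below.

Duality identifies `lam`. By convexity of `F` and minimality of `y`, the gradient of `F` at `y`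
gives the dual criterion a value of at least `F y`. A dual solution `lam` does at least as well,
which forces `lam` to be a subgradient of `F` at `y`, hence its gradient there, and forces
`⟪lam, y⟫` to be the mean of the `Φ i (lam)` (`IsDualSolution.eq_scaledGradient`). Writing
`y` as the mean of points `z i` of the convex hulls of the agent sets, each `z i` must lie on the
face where `⟪lam, ·⟫` is minimal, that is in the convex hull of the best responses of agent `i`
(`mem_convexHull_bestResponseSet`). In particular best responses exist.

It remains to round the `z i` to best responses `w i` while keeping the sum of the `w i` close to
that of the `z i`. By the Shapley–Folkman theorem (`shapley_folkman`) all but `q ∧ N` of the `z i`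
can be assumed to be best responses already. The others are means of distributions on the best
responses with variance close to at most `ρ ^ 2`; under independent sampling the variances add up,
so some realization is no worse than the average
(`exists_norm_sum_sub_sq_le_nonconvexityMeasure`).
Since `⟪lam, ·⟫` is constant on the best responses of each agent, the first-order term in the
descent inequality for `F` at `y` vanishes, and the rescaling by `√L̃` makes the second-order
constant equal to `1 / 2`.
-/

/-! ### Minimization and first-order conditions for convex functions on a Hilbert space -/

section ConvexAnalysis

open Filter Topology Set

variable {H : Type*} [NormedAddCommGroup H] [InnerProductSpace ℝ H]

/-- A decreasing sequence of nonempty closed convex subsets of a Hilbert space, the first of which is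
bounded, has a common point: the points of least norm form a Cauchy sequence. This replaces weak
compactness. -/
theorem nonempty_iInter_of_antitone_convex [CompleteSpace H] {C : ℕ → Set H}
    (hanti : Antitone C) (hne : ∀ n, (C n).Nonempty) (hcl : ∀ n, IsClosed (C n))
    (hcv : ∀ n, Convex ℝ (C n)) (hbd : Bornology.IsBounded (C 0)) :
    (⋂ n, C n).Nonempty := by
  have hproj : ∀ n, ∃ v ∈ C n, ∀ w ∈ C n, ‖v‖ ^ 2 ≤ inner ℝ v w := by
    intro n
    obtain ⟨v, hv, hmin⟩ :=
      exists_norm_eq_iInf_of_complete_convex (hne n) (hcl n).isComplete (hcv n) 0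
    refine ⟨v, hv, fun w hw => ?_⟩
    have := (norm_eq_iInf_iff_real_inner_le_zero (hcv n) hv).1 hmin w hw
    rw [zero_sub, inner_neg_left, inner_sub_right, real_inner_self_eq_norm_sq] at this
    linarith
  choose v hv hvmin using hproj
  have hdist : ∀ n k, n ≤ k → ‖v k - v n‖ ^ 2 ≤ ‖v k‖ ^ 2 - ‖v n‖ ^ 2 := by
    intro n k hnk
    have h := hvmin n (v k) (hanti hnk (hv k))
    rw [norm_sub_sq_real, real_inner_comm]
    linarith
  have hmono : Monotone fun n => ‖v n‖ ^ 2 := by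
    intro n k hnk
    have := hdist n k hnk
    have h0 := sq_nonneg ‖v k - v n‖
    simp only
    linarith
  have hbdd : BddAbove (range fun n => ‖v n‖ ^ 2) := by
    obtain ⟨R, hR⟩ := hbd.exists_norm_le
    refine ⟨R ^ 2, ?_⟩
    rintro _ ⟨n, rfl⟩
    have := hR (v n) (hanti (Nat.zero_le n) (hv n))
    simp only
    gcongr
  have hcauchy : CauchySeq v := by
    have h1 := (tendsto_atTop_ciSup hmono hbdd).cauchySeq
    rw [Metric.cauchySeq_iff'] at h1 ⊢
    intro ε hε
    obtain ⟨n, hn⟩ := h1 (ε ^ 2) (by positivity)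
    refine ⟨n, fun k hk => ?_⟩
    have h2 := hn k hk
    rw [Real.dist_eq] at h2
    have h3 := (hdist n k hk).trans_lt ((le_abs_self _).trans_lt h2)
    rw [dist_eq_norm]
    exact lt_of_pow_lt_pow_left₀ 2 hε.le h3
  obtain ⟨x, hx⟩ := cauchySeq_tendsto_of_complete hcauchy
  refine ⟨x, mem_iInter.2 fun n => ?_⟩
  exact (hcl n).mem_of_tendsto hx
    ((eventually_ge_atTop n).mono fun k hk => hanti hk (hv k))

/-- A convex lower semicontinuous function attains its infimum on a bounded closed convex set: the
sublevel sets just above the infimum have a common point. -/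
theorem exists_forall_le_of_convexOn_of_lsc [CompleteSpace H] {K : Set H} {F : H → ℝ}
    (hne : K.Nonempty) (hcl : IsClosed K) (hcv : Convex ℝ K) (hbd : Bornology.IsBounded K)
    (hF : LowerSemicontinuous F) (hFc : ConvexOn ℝ univ F) (hFb : BddBelow (F '' K)) :
    ∃ y ∈ K, ∀ z ∈ K, F y ≤ F z := by
  set m := sInf (F '' K)
  let C : ℕ → Set H := fun n => K ∩ {y | F y ≤ m + 1 / ((n : ℝ) + 1)}
  have hC : (⋂ n, C n).Nonempty := by
    refine nonempty_iInter_of_antitone_convex ?_ ?_ ?_ ?_ (hbd.subset inter_subset_left)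
    · intro n k hnk y hy
      have h1 := Nat.one_div_le_one_div (α := ℝ) hnk
      have h2 : F y ≤ _ := hy.2
      exact ⟨hy.1, show F y ≤ _ by linarith⟩
    · intro n
      obtain ⟨_, ⟨y, hy, rfl⟩, hlt⟩ := exists_lt_of_csInf_lt (hne.image F)
        (show m < m + 1 / ((n : ℝ) + 1) from lt_add_of_pos_right _ Nat.one_div_pos_of_nat)
      exact ⟨y, hy, hlt.le⟩
    · exact fun n => hcl.inter (hF.isClosed_preimage _)
    · intro n
      have := hFc.convex_le (m + 1 / ((n : ℝ) + 1))
      simp only [mem_univ, true_and] at this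
      exact hcv.inter this
  obtain ⟨y, hy⟩ := hC
  rw [mem_iInter] at hy
  refine ⟨y, (hy 0).1, fun z hz => ?_⟩
  have hle : F y ≤ m := by
    have hlim : Tendsto (fun n : ℕ => m + 1 / ((n : ℝ) + 1)) atTop (𝓝 (m + 0)) :=
      tendsto_const_nhds.add tendsto_one_div_add_atTop_nhds_zero_nat
    rw [add_zero] at hlim
    exact ge_of_tendsto' hlim fun n => (hy n).2
  exact hle.trans (csInf_le hFb ⟨z, hz, rfl⟩)

section Gradient

variable [CompleteSpace H]

theorem HasGradientAt.hasDerivAt_comp_lineMap {F : H → ℝ} {g x y : H} {t : ℝ}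
    (hF : HasGradientAt F g (AffineMap.lineMap x y t)) :
    HasDerivAt (fun s : ℝ => F (AffineMap.lineMap x y s)) (inner ℝ g (y - x)) t := by
  have h := hF.hasFDerivAt.comp_hasDerivAt t (AffineMap.hasDerivAt_lineMap (a := x) (b := y))
  rw [InnerProductSpace.toDual_apply_apply] at h
  exact h

theorem ConvexOn.add_inner_le_of_hasGradientAt {F : H → ℝ} (hF : ConvexOn ℝ univ F) {g x : H}
    (hg : HasGradientAt F g x) (y : H) : F x + inner ℝ g (y - x) ≤ F y := by
  have hc : ConvexOn ℝ univ (fun s : ℝ => F (AffineMap.lineMap x y s)) :=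
    hF.comp_affineMap (AffineMap.lineMap (k := ℝ) x y)
  have hd : HasDerivAt (fun s : ℝ => F (AffineMap.lineMap x y s)) (inner ℝ g (y - x)) 0 :=
    HasGradientAt.hasDerivAt_comp_lineMap (by simpa using hg)
  have := hc.le_slope_of_hasDerivAt (mem_univ 0) (mem_univ 1) one_pos hd
  simp [slope_def_field] at this
  linarith

/-- The descent lemma. Differentiability is needed at the points of `s` only, but in the ambient
space. -/
theorem le_add_inner_add_sq_of_lipschitzOnWith_gradient {F : H → ℝ} {s : Set H} {L : ℝ≥0}
    (hs : Convex ℝ s) (hF : ∀ x ∈ s, DifferentiableAt ℝ F x)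
    (hL : LipschitzOnWith L (gradient F) s) {a b : H} (ha : a ∈ s) (hb : b ∈ s) :
    F b ≤ F a + inner ℝ (gradient F a) (b - a) + L / 2 * ‖b - a‖ ^ 2 := by
  let φ : ℝ → ℝ := fun t => F (AffineMap.lineMap a b t) - t * inner ℝ (gradient F a) (b - a)
    - L / 2 * ‖b - a‖ ^ 2 * t ^ 2
  have hmem : ∀ t ∈ Icc (0 : ℝ) 1, AffineMap.lineMap a b t ∈ s :=
    fun t ht => hs.lineMap_mem ha hb ht
  have hder : ∀ t ∈ Icc (0 : ℝ) 1, HasDerivAt φ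
      (inner ℝ (gradient F (AffineMap.lineMap a b t)) (b - a) - inner ℝ (gradient F a) (b - a)
        - L / 2 * ‖b - a‖ ^ 2 * (2 * t)) t := by
    intro t ht
    have h1 := HasGradientAt.hasDerivAt_comp_lineMap (hF _ (hmem t ht)).hasGradientAt
    have h2 := (hasDerivAt_id t).mul_const (inner ℝ (gradient F a) (b - a))
    have h3 := (hasDerivAt_pow 2 t).const_mul (L / 2 * ‖b - a‖ ^ 2)
    rw [one_mul] at h2
    rw [Nat.cast_ofNat, pow_one] at h3
    exact (h1.sub h2).sub h3
  have hanti : AntitoneOn φ (Icc 0 1) := by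
    refine antitoneOn_of_deriv_nonpos (convex_Icc 0 1)
      (fun t ht => (hder t ht).continuousAt.continuousWithinAt)
      (fun t ht => (hder t (interior_subset ht)).differentiableAt.differentiableWithinAt) ?_
    intro t ht
    have ht' := interior_subset ht
    rw [(hder t ht').deriv, ← inner_sub_left]
    have h1 := real_inner_le_norm (gradient F (AffineMap.lineMap a b t) - gradient F a) (b - a)
    have h2 := hL.norm_sub_le (hmem t ht') ha
    have h3 : ‖(AffineMap.lineMap a b t : H) - a‖ = t * ‖b - a‖ := by
      rw [AffineMap.lineMap_apply, vsub_eq_sub, vadd_eq_add, add_sub_cancel_right, norm_smul,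
        Real.norm_of_nonneg ht'.1]
    rw [h3] at h2
    have h4 := mul_le_mul_of_nonneg_right h2 (norm_nonneg (b - a))
    nlinarith
  have := hanti (left_mem_Icc.2 zero_le_one) (right_mem_Icc.2 zero_le_one) zero_le_one
  simp only [φ, AffineMap.lineMap_apply_zero, AffineMap.lineMap_apply_one] at this
  linarith

/-- The only subgradient at a point of differentiability is the gradient. -/
theorem HasGradientAt.eq_of_forall_add_inner_le {F : H → ℝ} {g p x : H}
    (hg : HasGradientAt F g x) (hp : ∀ y, F x + inner ℝ p (y - x) ≤ F y) : p = g := by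
  have hmin : IsLocalMin (fun y => F y - inner ℝ p y) x := by
    refine Eventually.of_forall fun y => ?_
    have := hp y
    rw [inner_sub_right] at this
    simp only
    linarith
  have hd := hg.hasFDerivAt.sub (innerSL ℝ p).hasFDerivAt (x := x)
  have h0 := hmin.hasFDerivAt_eq_zero hd
  refine ext_inner_right ℝ fun v => ?_
  have := DFunLike.congr_fun h0 v
  simp at this
  linarith

theorem HasGradientAt.inner_sub_nonneg_of_forall_le {F : H → ℝ} {g x y : H} {K : Set H}
    (hg : HasGradientAt F g x) (hK : Convex ℝ K) (hx : x ∈ K) (hmin : ∀ z ∈ K, F x ≤ F z)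
    (hy : y ∈ K) : 0 ≤ inner ℝ g (y - x) := by
  have hloc : IsLocalMinOn F K x := eventually_nhdsWithin_of_forall hmin
  simpa using hloc.hasFDerivWithinAt_nonneg hg.hasFDerivAt.hasFDerivWithinAt
    (sub_mem_posTangentConeAt_of_segment_subset (hK.segment_subset hx hy))

end Gradient

/-- A point of `convexHull ℝ A` at which a linear form attains its lower bound on `A` is a convex
combination of points of `A` with the same property. -/
theorem mem_convexHull_face {V : Type*} [AddCommGroup V] [Module ℝ V] {A : Set V}
    (l : V →ₗ[ℝ] ℝ) {c : ℝ} (hc : ∀ a ∈ A, c ≤ l a) {y : V} (hy : y ∈ convexHull ℝ A)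
    (hyc : l y ≤ c) : y ∈ convexHull ℝ {a ∈ A | l a = c} := by
  let T : Set V := {z | c ≤ l z ∧ (l z = c → z ∈ convexHull ℝ {a ∈ A | l a = c})}
  have hT : Convex ℝ T := by
    rw [convex_iff_forall_pos]
    rintro u ⟨hu, hu'⟩ v ⟨hv, hv'⟩ a b ha hb hab
    have hl : l (a • u + b • v) = a * l u + b * l v := by simp
    have hcab : c = a * c + b * c := by rw [← add_mul, hab, one_mul]
    have hau := mul_le_mul_of_nonneg_left hu ha.le
    have hbv := mul_le_mul_of_nonneg_left hv hb.le
    refine ⟨by linarith, fun h => ?_⟩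
    have hu0 : l u = c := mul_left_cancel₀ ha.ne' (by linarith)
    have hv0 : l v = c := mul_left_cancel₀ hb.ne' (by linarith)
    exact convex_convexHull ℝ _ (hu' hu0) (hv' hv0) ha.le hb.le hab
  have hAT : A ⊆ T := fun a ha => ⟨hc a ha, fun h => subset_convexHull ℝ _ ⟨ha, h⟩⟩
  obtain ⟨h1, h2⟩ := convexHull_min hAT hT hy
  exact h2 (le_antisymm hyc h1)

end ConvexAnalysis

/-! ### Finitely supported distributions and their derandomization -/

section FiniteDistributions

variable {Ω H : Type*}

namespace FinProb

theorem expect_mem_convexHull [AddCommGroup H] [Module ℝ H] (μ : FinProb Ω) (F : Ω → H) :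
    expect μ F ∈ convexHull ℝ (Set.range F) :=
  (convex_convexHull ℝ _).sum_mem (fun x _ => μ.weights_nonneg x) μ.total
    fun x _ => subset_convexHull ℝ _ ⟨x, rfl⟩

theorem map_expect [AddCommGroup H] [Module ℝ H] {H' : Type*} [AddCommGroup H'] [Module ℝ H']
    (l : H →ₗ[ℝ] H') (μ : FinProb Ω) (F : Ω → H) :
    l (expect μ F) = expect μ fun x => l (F x) := by
  simp [expect, Finsupp.sum]

theorem expect_single [AddCommGroup H] [Module ℝ H] (x : Ω) (F : Ω → H) :
    expect (Convexity.StdSimplex.single x) F = F x := by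
  simp [expect]

theorem variance_single [NormedAddCommGroup H] [NormedSpace ℝ H] (x : Ω) (F : Ω → H) :
    variance (Convexity.StdSimplex.single x) F = 0 := by
  simp [variance, expect_single]

theorem variance_nonneg [NormedAddCommGroup H] [NormedSpace ℝ H] (μ : FinProb Ω) (F : Ω → H) :
    0 ≤ variance μ F :=
  Finset.sum_nonneg fun x _ => mul_nonneg (μ.weights_nonneg x) (sq_nonneg _)

theorem exists_expect_eq_of_mem_convexHull [AddCommGroup H] [Module ℝ H] {K : Set H} {y : H}
    (hy : y ∈ convexHull ℝ K) : ∃ μ : FinProb K, expect μ (fun k => (k : H)) = y := by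
  obtain ⟨ι, _, w, z, hw0, hw1, hz, rfl⟩ := mem_convexHull_iff_exists_fintype.1 hy
  let ν : FinProb ι := ⟨Finsupp.equivFunOnFinite.symm w, hw0, by
    rw [Finsupp.sum_fintype _ _ fun _ => rfl]; exact hw1⟩
  refine ⟨ν.map fun i => ⟨z i, hz i⟩, ?_⟩
  rw [expect, Convexity.StdSimplex.weights_map, Finsupp.sum_mapDomain_index (by simp)
    (by simp [add_smul]), Finsupp.sum_fintype _ _ (by simp)]
  rfl

theorem variance_le_of_norm_le [NormedAddCommGroup H] [NormedSpace ℝ H] (μ : FinProb Ω)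
    {F : Ω → H} {R : ℝ} (hF : ∀ x, ‖F x‖ ≤ R) : variance μ F ≤ (2 * R) ^ 2 := by
  have hE : ‖expect μ F‖ ≤ R := by
    have hsub : convexHull ℝ (Set.range F) ⊆ Metric.closedBall 0 R := by
      refine convexHull_min ?_ (convex_closedBall 0 R)
      rintro _ ⟨x, rfl⟩
      simpa using hF x
    simpa using hsub (expect_mem_convexHull μ F)
  calc variance μ F ≤ μ.weights.sum fun _ r => r * (2 * R) ^ 2 := by
        refine Finset.sum_le_sum fun x _ => mul_le_mul_of_nonneg_left ?_ (μ.weights_nonneg x)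
        have := norm_sub_le (F x) (expect μ F)
        have := hF x
        gcongr
        linarith
    _ = (2 * R) ^ 2 := by
        have := μ.total
        rw [Finsupp.sum] at this ⊢
        rw [← Finset.sum_mul, this, one_mul]

/-- Some realization does no worse than the average, for a shifted and centered variable. -/
theorem exists_norm_add_sub_expect_sq_le [NormedAddCommGroup H] [InnerProductSpace ℝ H]
    (μ : FinProb Ω) (F : Ω → H) (z : H) :
    ∃ x, ‖z + (F x - expect μ F)‖ ^ 2 ≤ ‖z‖ ^ 2 + variance μ F := by
  have htot : ∑ x ∈ μ.weights.support, μ.weights x = 1 := μ.total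
  have hsum : ∑ x ∈ μ.weights.support, μ.weights x * ‖z + (F x - expect μ F)‖ ^ 2
      = ‖z‖ ^ 2 + variance μ F := by
    have hcross : ∑ x ∈ μ.weights.support, μ.weights x * inner ℝ z (F x - expect μ F) = 0 := by
      simp_rw [← real_inner_smul_right, ← inner_sum, smul_sub, Finset.sum_sub_distrib,
        ← Finset.sum_smul, htot, one_smul]
      rw [show ∑ x ∈ μ.weights.support, μ.weights x • F x = expect μ F from rfl, sub_self,
        inner_zero_right]
    calc ∑ x ∈ μ.weights.support, μ.weights x * ‖z + (F x - expect μ F)‖ ^ 2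
        = ∑ x ∈ μ.weights.support, (μ.weights x * ‖z‖ ^ 2
            + 2 * (μ.weights x * inner ℝ z (F x - expect μ F))
            + μ.weights x * ‖F x - expect μ F‖ ^ 2) := by
          refine Finset.sum_congr rfl fun x _ => ?_
          rw [norm_add_sq_real]
          ring
      _ = ‖z‖ ^ 2 + variance μ F := by
          rw [Finset.sum_add_distrib, Finset.sum_add_distrib, ← Finset.sum_mul, ← Finset.mul_sum,
            hcross, htot]
          simp [variance, Finsupp.sum]
  obtain ⟨x, hx, hle⟩ := Finset.exists_le_of_sum_le μ.support_weights_nonempty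
    (f := fun x => μ.weights x * ‖z + (F x - expect μ F)‖ ^ 2)
    (g := fun x => μ.weights x * (‖z‖ ^ 2 + variance μ F))
    (by rw [hsum, ← Finset.sum_mul, htot, one_mul])
  exact ⟨x, le_of_mul_le_mul_left hle
    (lt_of_le_of_ne (μ.weights_nonneg x) (Finsupp.mem_support_iff.1 hx).symm)⟩

/-- Derandomization of an independent sum: the expected squared norm of the centered sum would be the
sum of the variances, and the choices can be made one index after the other, so that no product
distribution is needed. -/
theorem exists_norm_sum_sub_expect_sq_le [NormedAddCommGroup H] [InnerProductSpace ℝ H]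
    {ι : Type*} {Ω : ι → Type*} (s : Finset ι) (μ : ∀ i, FinProb (Ω i)) (F : ∀ i, Ω i → H) :
    ∃ x : ∀ i, Ω i, ‖∑ i ∈ s, (F i (x i) - expect (μ i) (F i))‖ ^ 2
      ≤ ∑ i ∈ s, variance (μ i) (F i) := by
  classical
  induction s using Finset.induction_on with
  | empty => exact ⟨fun i => (μ i).nonempty.some, by simp⟩
  | insert a s ha ih =>
    obtain ⟨x, hx⟩ := ih
    obtain ⟨b, hb⟩ := exists_norm_add_sub_expect_sq_le (μ a) (F a)
      (∑ i ∈ s, (F i (x i) - expect (μ i) (F i)))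
    refine ⟨Function.update x a b, ?_⟩
    rw [Finset.sum_insert ha, Finset.sum_insert ha, Function.update_self, add_comm]
    have hs : ∑ i ∈ s, (F i (Function.update x a b i) - expect (μ i) (F i))
        = ∑ i ∈ s, (F i (x i) - expect (μ i) (F i)) :=
      Finset.sum_congr rfl fun i hi => by
        rw [Function.update_of_ne (ne_of_mem_of_not_mem hi ha)]
    rw [hs]
    linarith

end FinProb

/-- The supremum and the infimum in the definition of `nonconvexityMeasure K` are genuine when `K` is
bounded, so every point of the convex hull is the mean of a distribution of variance almost at most
`ρ(K) ^ 2`. -/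
theorem exists_variance_le_nonconvexityMeasure_sq_add [NormedAddCommGroup H] [NormedSpace ℝ H]
    {K : Set H} (hK : Bornology.IsBounded K) {y : H} (hy : y ∈ convexHull ℝ K) {δ : ℝ}
    (hδ : 0 < δ) :
    ∃ μ : FinProb K, FinProb.expect μ (fun k => (k : H)) = y ∧
      FinProb.variance μ (fun k => (k : H)) ≤ nonconvexityMeasure K ^ 2 + δ := by
  let v : convexHull ℝ K → ℝ := fun y =>
    ⨅ μ : {μ : FinProb K // FinProb.expect μ (fun k => (k : H)) = (y : H)},
      FinProb.variance μ.1 (fun k => (k : H))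
  have hv0 : ∀ y, 0 ≤ v y := fun y => Real.iInf_nonneg fun μ => μ.1.variance_nonneg _
  obtain ⟨R, hR⟩ := hK.exists_norm_le
  have hbdd : BddAbove (Set.range v) := by
    refine ⟨(2 * R) ^ 2, ?_⟩
    rintro _ ⟨y, rfl⟩
    obtain ⟨μ, hμ⟩ := FinProb.exists_expect_eq_of_mem_convexHull y.2
    refine (ciInf_le ⟨0, ?_⟩ ⟨μ, hμ⟩).trans (μ.variance_le_of_norm_le fun k => hR k k.2)
    rintro _ ⟨ν, rfl⟩
    exact ν.1.variance_nonneg _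
  have hρ : nonconvexityMeasure K ^ 2 = ⨆ y, v y := Real.sq_sqrt (Real.iSup_nonneg hv0)
  have hvy : v ⟨y, hy⟩ < nonconvexityMeasure K ^ 2 + δ := by
    rw [hρ]
    exact (le_ciSup hbdd ⟨y, hy⟩).trans_lt (lt_add_of_pos_right _ hδ)
  obtain ⟨μ, hμ⟩ := FinProb.exists_expect_eq_of_mem_convexHull hy
  have : Nonempty {μ : FinProb K // FinProb.expect μ (fun k => (k : H)) = y} := ⟨μ, hμ⟩
  obtain ⟨ν, hν⟩ := exists_lt_of_ciInf_lt hvy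
  exact ⟨ν.1, ν.2, hν.le⟩

end FiniteDistributions

/-! ### The Shapley–Folkman theorem and Starr's bound -/

section ShapleyFolkman

open Finset

/-- The **Shapley–Folkman theorem**. Carathéodory's theorem is applied to the mean of the
`(x i, e i)` in `V × (ι → ℝ)`, where `e i` are the standard basis vectors, and to the union of the
`S i × {e i}`. As the last coordinates sum to one, the affinely independent points it gives are
linearly independent; so there are at most `finrank V + card ι` of them, at least one for each `i`. -/
theorem shapley_folkman {V ι : Type*} [AddCommGroup V] [Module ℝ V] [FiniteDimensional ℝ V]
    [Fintype ι] {S : ι → Set V} {x : ι → V} (hx : ∀ i, x i ∈ convexHull ℝ (S i)) :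
    ∃ (y : ι → V) (B : Finset ι), (∀ i, y i ∈ convexHull ℝ (S i)) ∧ (∀ i ∉ B, y i ∈ S i) ∧
      ∑ i, y i = ∑ i, x i ∧ #B ≤ Module.finrank ℝ V := by
  classical
  cases isEmpty_or_nonempty ι with
  | inl h => exact ⟨x, ∅, hx, fun i => h.elim i, rfl, by simp⟩
  | inr _ =>
  set n : ℝ := (Fintype.card ι : ℝ)
  have hn : 0 < n := by simpa [n] using Fintype.card_pos (α := ι)
  let A : Set (V × (ι → ℝ)) := ⋃ i, S i ×ˢ {Pi.single i 1}
  have hp : ∑ i, n⁻¹ • (x i, (Pi.single i 1 : ι → ℝ)) ∈ convexHull ℝ A := by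
    refine (convex_convexHull ℝ A).sum_mem (fun _ _ => by positivity) ?_ fun i _ => ?_
    · rw [sum_const, card_univ, nsmul_eq_mul]
      exact mul_inv_cancel₀ hn.ne'
    · have hsub : S i ×ˢ {(Pi.single i 1 : ι → ℝ)} ⊆ A := fun p hp => Set.mem_iUnion.2 ⟨i, hp⟩
      have hmem : (x i, (Pi.single i 1 : ι → ℝ)) ∈
          convexHull ℝ (S i ×ˢ {(Pi.single i 1 : ι → ℝ)}) := by
        rw [convexHull_prod, convexHull_singleton]
        exact ⟨hx i, Set.mem_singleton _⟩
      exact convexHull_mono hsub hmem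
  obtain ⟨κ, _, z, w, hzA, hzind, hw0, -, hwz⟩ := eq_pos_convex_span_of_mem_convexHull hp
  have hidx : ∀ k, ∃ i, (z k).1 ∈ S i ∧ (z k).2 = Pi.single i 1 := fun k => by
    simpa [A] using hzA (Set.mem_range_self k)
  choose idx hzS hze using hidx
  have hlin : LinearIndependent ℝ z := by
    rw [linearIndependent_iff']
    intro s c hc
    refine affineIndependent_iff.1 hzind s c ?_ hc
    have := congrArg (fun p : V × (ι → ℝ) => ∑ i, p.2 i) hc
    simpa [Prod.snd_sum, hze, sum_comm (s := univ), ← mul_sum] using this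
  have hcard : Fintype.card κ ≤ Module.finrank ℝ V + Fintype.card ι := by
    simpa using hlin.fintype_card_le_finrank
  have hfib : ∀ i, ∑ k with idx k = i, w k = n⁻¹ := fun i => by
    have := congrArg (fun p : V × (ι → ℝ) => p.2 i) hwz
    simpa [Prod.snd_sum, hze, Pi.single_apply, sum_filter, eq_comm] using this
  have hfib_ne : ∀ i, 1 ≤ #{k | idx k = i} := fun i => by
    rw [Nat.one_le_iff_ne_zero, Finset.card_ne_zero]
    by_contra h
    have := hfib i
    rw [not_nonempty_iff_eq_empty.1 h, sum_empty] at this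
    exact (inv_pos.2 hn).ne this
  let y : ι → V := fun i => ∑ k with idx k = i, (n * w k) • (z k).1
  refine ⟨y, univ.filter fun i => y i ∉ S i, fun i => ?_, fun i hi => by simpa using hi, ?_, ?_⟩
  · refine (convex_convexHull ℝ _).sum_mem (fun k _ => mul_nonneg hn.le (hw0 k).le) ?_ ?_
    · rw [← mul_sum, hfib, mul_inv_cancel₀ hn.ne']
    · intro k hk
      rw [mem_filter] at hk
      exact subset_convexHull ℝ _ (hk.2 ▸ hzS k)
  · have := congrArg (fun p : V × (ι → ℝ) => n • p.1) hwz
    simp only [Prod.fst_sum, Prod.smul_fst, smul_sum, smul_smul, mul_inv_cancel₀ hn.ne',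
      one_smul] at this
    rw [← this, ← sum_fiberwise univ idx]
  · have hge : ∀ i, 1 + (if y i ∉ S i then 1 else 0) ≤ #{k | idx k = i} := fun i => by
      by_cases hi : y i ∈ S i
      · simpa only [hi, not_true, if_false, add_zero] using hfib_ne i
      · rw [if_pos hi]
        -- A single point in the fiber has weight `n⁻¹`, so `y i` is that point of `S i`.
        by_contra hlt
        obtain ⟨k, hk⟩ := card_eq_one.1 (le_antisymm (by omega) (hfib_ne i))
        have hki := mem_singleton_self k
        rw [← hk, mem_filter] at hki
        replace hki := hki.2
        have hwk := hfib i
        rw [hk, sum_singleton] at hwk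
        refine hi ?_
        simp only [y, hk, sum_singleton, hwk, mul_inv_cancel₀ hn.ne', one_smul]
        exact hki ▸ hzS k
    have hsum := sum_le_sum fun i (_ : i ∈ univ) => hge i
    rw [← card_eq_sum_card_fiberwise (s := univ) (t := univ) (f := idx) (by simp),
      sum_add_distrib, sum_boole, sum_const, card_univ, card_univ] at hsum
    simp at hsum
    simp
    omega

/-- The Shapley–Folkman theorem without finiteness assumption on the dimension, with an exceptional
set of exactly `min (dim V) (card ι)` elements. -/
theorem shapley_folkman_rank {V ι : Type*} [AddCommGroup V] [Module ℝ V]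
    [Fintype ι] {S : ι → Set V} {x : ι → V} (hx : ∀ i, x i ∈ convexHull ℝ (S i)) :
    ∃ (y : ι → V) (B : Finset ι), (∀ i, y i ∈ convexHull ℝ (S i)) ∧ (∀ i ∉ B, y i ∈ S i) ∧
      ∑ i, y i = ∑ i, x i ∧
      #B = (min (Cardinal.toENat (Module.rank ℝ V)) (Fintype.card ι : ℕ∞)).toNat := by
  suffices h : ∃ (y : ι → V) (B : Finset ι), (∀ i, y i ∈ convexHull ℝ (S i)) ∧
      (∀ i ∉ B, y i ∈ S i) ∧ ∑ i, y i = ∑ i, x i ∧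
      #B ≤ (min (Cardinal.toENat (Module.rank ℝ V)) (Fintype.card ι : ℕ∞)).toNat by
    obtain ⟨y, B, hy, hB, hsum, hcard⟩ := h
    have hle : (min (Cardinal.toENat (Module.rank ℝ V)) (Fintype.card ι : ℕ∞)).toNat
        ≤ Fintype.card ι :=
      ENat.toNat_le_of_le_natCast (min_le_right _ _)
    obtain ⟨B', hBB', hB'⟩ := exists_superset_card_eq hcard hle
    exact ⟨y, B', hy, fun i hi => hB i fun h => hi (hBB' h), hsum, hB'⟩
  rcases le_total (Fintype.card ι : ℕ∞) (Cardinal.toENat (Module.rank ℝ V)) with h | h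
  · exact ⟨x, univ, hx, fun i hi => absurd (mem_univ i) hi, rfl, by simp [min_eq_right h]⟩
  · have hfin : FiniteDimensional ℝ V := by
      rw [FiniteDimensional, ← Module.rank_lt_aleph0_iff, ← Cardinal.toENat_lt_top]
      exact h.trans_lt (ENat.natCast_lt_top _)
    obtain ⟨y, B, hy, hB, hsum, hcard⟩ := shapley_folkman hx
    refine ⟨y, B, hy, hB, hsum, hcard.trans_eq ?_⟩
    rw [min_eq_left h]
    rfl

/-- Starr's bound on the distance between a sum of points of convex hulls and a sum of points of the
original sets. -/
theorem exists_norm_sum_sub_sq_le_nonconvexityMeasure {H ι : Type*} [NormedAddCommGroup H]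
    [InnerProductSpace ℝ H] [Fintype ι] {S : ι → Set H}
    (hS : ∀ i, Bornology.IsBounded (S i)) {x : ι → H} (hx : ∀ i, x i ∈ convexHull ℝ (S i))
    {ε : ℝ} (hε : 0 < ε) :
    ∃ (y : ι → H) (Q : Finset ι), (∀ i, y i ∈ S i) ∧
      #Q = (min (Cardinal.toENat (Module.rank ℝ H)) (Fintype.card ι : ℕ∞)).toNat ∧
      ‖∑ i, y i - ∑ i, x i‖ ^ 2 ≤ ∑ i ∈ Q, nonconvexityMeasure (S i) ^ 2 + ε := by
  classical
  obtain ⟨x', Q, hx', hQ, hsum, hcard⟩ := shapley_folkman_rank hx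
  -- The error `ε` is shared equally between the agents; the `+ 1` avoids dividing by zero.
  set δ : ℝ := ε / (Fintype.card ι + 1)
  have hδ : 0 < δ := by positivity
  have hμ : ∀ i, ∃ μ : FinProb (S i), FinProb.expect μ (fun k => (k : H)) = x' i ∧
      FinProb.variance μ (fun k => (k : H))
        ≤ (if i ∈ Q then nonconvexityMeasure (S i) ^ 2 else 0) + δ := fun i => by
    split_ifs with hi
    · exact exists_variance_le_nonconvexityMeasure_sq_add (hS i) (hx' i) hδ
    · refine ⟨.single ⟨x' i, hQ i hi⟩, FinProb.expect_single _ _, ?_⟩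
      rw [FinProb.variance_single, zero_add]
      exact hδ.le
  choose μ hμE hμV using hμ
  obtain ⟨y, hy⟩ := FinProb.exists_norm_sum_sub_expect_sq_le univ μ fun i k => (k : H)
  refine ⟨fun i => y i, Q, fun i => (y i).2, hcard, ?_⟩
  simp only [hμE, sum_sub_distrib, hsum] at hy
  refine hy.trans ((sum_le_sum fun i _ => hμV i).trans ?_)
  rw [sum_add_distrib, sum_ite_mem, univ_inter, sum_const, card_univ, nsmul_eq_mul]
  gcongr
  rw [mul_div_assoc', div_le_iff₀ (by positivity)]
  nlinarith

end ShapleyFolkman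

/-! ### Rescaling, best responses and duality for aggregative problems -/

noncomputable section

namespace AggregativeProblem

variable {N M : ℕ} {X : Fin N → Type*} {E : Fin M → Type*}
  [∀ j, NormedAddCommGroup (E j)] [∀ j, InnerProductSpace ℝ (E j)]

/-- The linear change of variables `y ↦ (√L̃_j y_j)_j`. -/
def scaleMap (P : AggregativeProblem X E) : PiLp 2 E →ₗ[ℝ] PiLp 2 E where
  toFun y := WithLp.toLp 2 fun j => Real.sqrt (P.Lt j) • y j
  map_add' y z := by ext j; exact smul_add _ _ _
  map_smul' c y := by ext j; exact smul_comm _ _ _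

/-- The `j`-th coordinate of the inverse of the change of variables `y ↦ (√L̃_j y_j)_j`. -/
def unscaledCoord (P : AggregativeProblem X E) (j : Fin M) : PiLp 2 E →L[ℝ] E j :=
  (Real.sqrt (P.Lt j))⁻¹ • PiLp.proj 2 E j

theorem unscaledCoord_apply (P : AggregativeProblem X E) (j : Fin M) (y : PiLp 2 E) :
    P.unscaledCoord j y = (Real.sqrt (P.Lt j))⁻¹ • y j := rfl

theorem scaledCost_eq_sum (P : AggregativeProblem X E) (y : PiLp 2 E) :
    P.scaledCost y = ∑ j, P.f j (P.unscaledCoord j y) := rfl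

theorem unscaledCoord_scaleMap (P : AggregativeProblem X E) (hLt : ∀ j, 0 < P.Lt j)
    (y : PiLp 2 E) (j : Fin M) : P.unscaledCoord j (P.scaleMap y) = y j :=
  inv_smul_smul₀ (Real.sqrt_pos.2 (NNReal.coe_pos.2 (hLt j))).ne' _

theorem scaledCost_scaleMap (P : AggregativeProblem X E) (hLt : ∀ j, 0 < P.Lt j)
    (y : PiLp 2 E) : P.scaledCost (P.scaleMap y) = P.cost y := by
  simp_rw [scaledCost_eq_sum, P.unscaledCoord_scaleMap hLt, cost]

theorem J_eq_scaledCost (P : AggregativeProblem X E) (hLt : ∀ j, 0 < P.Lt j) (x : ∀ i, X i) :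
    P.J x = P.scaledCost ((N : ℝ)⁻¹ • ∑ i, P.scaledContribution i (x i)) := by
  rw [J, ← P.scaledCost_scaleMap hLt, aggregate, map_smul, map_sum]
  rfl

theorem Jrand_eq_scaledCost (P : AggregativeProblem X E) (hLt : ∀ j, 0 < P.Lt j)
    (μ : ∀ i, FinProb (X i)) :
    P.Jrand μ = P.scaledCost
      ((N : ℝ)⁻¹ • ∑ i, FinProb.expect (μ i) (P.scaledContribution i)) := by
  rw [Jrand, ← P.scaledCost_scaleMap hLt, map_smul, map_sum]
  simp_rw [FinProb.map_expect]
  rfl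

theorem J_eq_Jrand_single (P : AggregativeProblem X E) (x : ∀ i, X i) :
    P.J x = P.Jrand fun i => .single (x i) := by
  simp_rw [J, Jrand, aggregate, FinProb.expect_single]

theorem convexHull_aggregateSet (P : AggregativeProblem X E) :
    convexHull ℝ P.aggregateSet = (N : ℝ)⁻¹ • ∑ i, convexHull ℝ (P.agentSet i) := by
  rw [aggregateSet, convexHull_smul, convexHull_sum]

theorem smul_sum_mem_convexHull_aggregateSet (P : AggregativeProblem X E)
    {z : Fin N → PiLp 2 E} (hz : ∀ i, z i ∈ convexHull ℝ (P.agentSet i)) :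
    (N : ℝ)⁻¹ • ∑ i, z i ∈ convexHull ℝ P.aggregateSet := by
  rw [convexHull_aggregateSet]
  exact Set.smul_mem_smul_set (Set.finsetSum_mem_finsetSum _ _ _ fun i _ => hz i)

theorem exists_eq_smul_sum_of_mem_convexHull_aggregateSet (P : AggregativeProblem X E)
    {y : PiLp 2 E} (hy : y ∈ convexHull ℝ P.aggregateSet) :
    ∃ z : Fin N → PiLp 2 E, (∀ i, z i ∈ convexHull ℝ (P.agentSet i)) ∧
      y = (N : ℝ)⁻¹ • ∑ i, z i := by
  rw [convexHull_aggregateSet] at hy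
  obtain ⟨_, hs, rfl⟩ := hy
  obtain ⟨z, hz, rfl⟩ := (Set.mem_fintype_sum _ _).1 hs
  exact ⟨z, hz, rfl⟩

theorem exists_eq_of_mem_aggregateSet (P : AggregativeProblem X E)
    {y : PiLp 2 E} (hy : y ∈ P.aggregateSet) :
    ∃ x : ∀ i, X i, y = (N : ℝ)⁻¹ • ∑ i, P.scaledContribution i (x i) := by
  obtain ⟨_, hs, rfl⟩ := hy
  obtain ⟨z, hz, rfl⟩ := (Set.mem_fintype_sum _ _).1 hs
  choose x hx using hz
  exact ⟨x, by simp_rw [hx]⟩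

theorem aggregateSet_nonempty (P : AggregativeProblem X E) [∀ i, Nonempty (X i)] :
    P.aggregateSet.Nonempty :=
  ⟨_, Set.smul_mem_smul_set (Set.finsetSum_mem_finsetSum _ _ (fun i =>
    P.scaledContribution i (Classical.arbitrary (X i))) fun _ _ => ⟨_, rfl⟩)⟩

theorem unscaledCoord_mem_convexHull_meanRangeSet (P : AggregativeProblem X E)
    (hLt : ∀ j, 0 < P.Lt j) {y : PiLp 2 E} (hy : y ∈ convexHull ℝ P.aggregateSet) (j : Fin M) :
    P.unscaledCoord j y ∈ convexHull ℝ (P.meanRangeSet j) := by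
  have himage : P.unscaledCoord j '' P.aggregateSet ⊆ P.meanRangeSet j := by
    rintro _ ⟨y, hy, rfl⟩
    obtain ⟨x, rfl⟩ := P.exists_eq_of_mem_aggregateSet hy
    rw [map_smul, map_sum]
    refine Set.smul_mem_smul_set (Set.finsetSum_mem_finsetSum _ _ _ fun i _ => ⟨x i, ?_⟩)
    exact (P.unscaledCoord_scaleMap hLt (P.contribution i (x i)) j).symm
  refine convexHull_mono himage ?_
  have := (P.unscaledCoord j).toLinearMap.image_convexHull P.aggregateSet
  exact this ▸ Set.mem_image_of_mem _ hy

theorem agentSet_isBounded (P : AggregativeProblem X E)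
    (hb : ∀ i j, Bornology.IsBounded (P.rangeSet i j)) (i : Fin N) :
    Bornology.IsBounded (P.agentSet i) := by
  choose R hR using fun j => (hb i j).exists_norm_le
  refine isBounded_iff_forall_norm_le.2
    ⟨Real.sqrt (∑ j, (Real.sqrt (P.Lt j) * R j) ^ 2), ?_⟩
  rintro _ ⟨x, rfl⟩
  refine Real.le_sqrt_of_sq_le ?_
  rw [PiLp.norm_sq_eq_of_L2]
  refine Finset.sum_le_sum fun j _ => ?_
  rw [scaledContribution, norm_smul, Real.norm_of_nonneg (Real.sqrt_nonneg _)]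
  have := hR j _ ⟨x, rfl⟩
  gcongr

theorem convexHull_aggregateSet_isBounded (P : AggregativeProblem X E)
    (hb : ∀ i j, Bornology.IsBounded (P.rangeSet i j)) :
    Bornology.IsBounded (convexHull ℝ P.aggregateSet) := by
  rw [isBounded_convexHull]
  choose R hR using fun i => (P.agentSet_isBounded hb i).exists_norm_le
  refine isBounded_iff_forall_norm_le.2 ⟨(N : ℝ)⁻¹ * ∑ i, R i, fun y hy => ?_⟩
  obtain ⟨x, rfl⟩ := P.exists_eq_of_mem_aggregateSet hy
  rw [norm_smul, Real.norm_of_nonneg (by positivity)]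
  gcongr
  exact norm_sum_le_of_le _ fun i _ => hR i _ ⟨x i, rfl⟩

theorem scaledCost_lowerSemicontinuous (P : AggregativeProblem X E)
    (hf : ∀ j, LowerSemicontinuous (P.f j)) : LowerSemicontinuous P.scaledCost :=
  lowerSemicontinuous_sum fun j _ => (hf j).comp (P.unscaledCoord j).continuous

theorem scaledCost_convexOn (P : AggregativeProblem X E)
    (hf : ∀ j, ConvexOn ℝ Set.univ (P.f j)) : ConvexOn ℝ Set.univ P.scaledCost := by
  refine ⟨convex_univ, fun y _ z _ a b ha hb hab => ?_⟩
  simp_rw [scaledCost_eq_sum, Finset.smul_sum, ← Finset.sum_add_distrib, map_add, map_smul]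
  exact Finset.sum_le_sum fun j _ => (hf j).2 trivial trivial ha hb hab

theorem Phi_le_inner (P : AggregativeProblem X E) {lam z : PiLp 2 E} {i : Fin N}
    (hb : Bornology.IsBounded (P.agentSet i)) (hz : z ∈ convexHull ℝ (P.agentSet i)) :
    P.Phi i lam ≤ inner ℝ lam z := by
  obtain ⟨R, hR⟩ := hb.exists_norm_le
  have hbdd : BddBelow (Set.range fun x => (inner ℝ lam (P.scaledContribution i x) : ℝ)) := by
    refine ⟨-(‖lam‖ * R), ?_⟩
    rintro _ ⟨x, rfl⟩
    have h1 := abs_le.1 (abs_real_inner_le_norm lam (P.scaledContribution i x))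
    have h2 := mul_le_mul_of_nonneg_left (hR _ ⟨x, rfl⟩) (norm_nonneg lam)
    simp only
    linarith
  have hconv : Convex ℝ {w : PiLp 2 E | P.Phi i lam ≤ inner ℝ lam w} :=
    convex_halfSpace_ge (innerSL ℝ lam).toLinearMap.isLinear _
  refine convexHull_min ?_ hconv hz
  rintro _ ⟨x, rfl⟩
  exact ciInf_le hbdd x

/-- Infima over the agents decouple: the mean of the `Φ i` is the infimum of `⟪lam, ·⟫` over the
aggregate set. -/
theorem le_smul_sum_Phi (P : AggregativeProblem X E) [∀ i, Nonempty (X i)] (hN : 0 < N)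
    {lam : PiLp 2 E} {c : ℝ} (hc : ∀ y ∈ convexHull ℝ P.aggregateSet, c ≤ inner ℝ lam y) :
    c ≤ (N : ℝ)⁻¹ * ∑ i, P.Phi i lam := by
  refine le_of_forall_pos_le_add fun ε hε => ?_
  have hx : ∀ i, ∃ x : X i, inner ℝ lam (P.scaledContribution i x) < P.Phi i lam + ε :=
    fun i => exists_lt_of_ciInf_lt (lt_add_of_pos_right _ hε)
  choose x hx using hx
  have hN' : (0 : ℝ) < N := Nat.cast_pos.2 hN
  calc c ≤ inner ℝ lam ((N : ℝ)⁻¹ • ∑ i, P.scaledContribution i (x i)) :=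
        hc _ (P.smul_sum_mem_convexHull_aggregateSet
          fun i => subset_convexHull ℝ _ ⟨x i, rfl⟩)
    _ = (N : ℝ)⁻¹ * ∑ i, inner ℝ lam (P.scaledContribution i (x i)) := by
        rw [real_inner_smul_right, inner_sum]
    _ ≤ (N : ℝ)⁻¹ * ∑ i, (P.Phi i lam + ε) := by
        gcongr with i
        exact (hx i).le
    _ = (N : ℝ)⁻¹ * ∑ i, P.Phi i lam + ε := by
        rw [Finset.sum_add_distrib, Finset.sum_const, Finset.card_univ, Fintype.card_fin,
          nsmul_eq_mul, mul_add, inv_mul_cancel_left₀ hN'.ne']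

theorem le_dualObjective (P : AggregativeProblem X E) {lam : PiLp 2 E} {c : ℝ}
    (hc : ∀ y, inner ℝ lam y - P.scaledCost y ≤ c) :
    ((-c + (N : ℝ)⁻¹ * ∑ i, P.Phi i lam : ℝ) : EReal) ≤ P.dualObjective lam := by
  rw [EReal.coe_add, EReal.coe_neg]
  refine add_le_add ?_ le_rfl
  rw [EReal.neg_le_neg_iff]
  exact iSup_le fun y => EReal.coe_le_coe_iff.2 (hc y)

theorem dualObjective_le (P : AggregativeProblem X E) (lam y : PiLp 2 E) :
    P.dualObjective lam ≤
      ((-(inner ℝ lam y - P.scaledCost y) + (N : ℝ)⁻¹ * ∑ i, P.Phi i lam : ℝ) : EReal) := by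
  rw [EReal.coe_add, EReal.coe_neg]
  refine add_le_add ?_ le_rfl
  rw [EReal.neg_le_neg_iff]
  exact le_iSup (fun y => ((inner ℝ lam y - P.scaledCost y : ℝ) : EReal)) y

theorem bestResponseSet_isBounded (P : AggregativeProblem X E)
    (hb : ∀ i j, Bornology.IsBounded (P.rangeSet i j)) (lam : PiLp 2 E) (i : Fin N) :
    Bornology.IsBounded (P.bestResponseSet lam i) :=
  (P.agentSet_isBounded hb i).subset fun _ h => h.1

theorem inner_eq_Phi_of_mem_bestResponseSet (P : AggregativeProblem X E)
    {lam y : PiLp 2 E} {i : Fin N} (hb : Bornology.IsBounded (P.agentSet i))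
    (hy : y ∈ P.bestResponseSet lam i) : inner ℝ lam y = P.Phi i lam := by
  have : Nonempty (X i) := by
    obtain ⟨⟨x, -⟩, -⟩ := hy
    exact ⟨x⟩
  exact le_antisymm (le_ciInf fun x => hy.2 _ ⟨x, rfl⟩)
    (P.Phi_le_inner hb (subset_convexHull ℝ _ hy.1))

theorem mem_convexHull_bestResponseSet (P : AggregativeProblem X E)
    {lam z : PiLp 2 E} {i : Fin N} (hb : Bornology.IsBounded (P.agentSet i))
    (hz : z ∈ convexHull ℝ (P.agentSet i)) (hle : inner ℝ lam z ≤ P.Phi i lam) :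
    z ∈ convexHull ℝ (P.bestResponseSet lam i) := by
  refine convexHull_mono ?_ (mem_convexHull_face (innerSL ℝ lam).toLinearMap
    (fun a ha => P.Phi_le_inner (lam := lam) hb (subset_convexHull ℝ _ ha)) hz hle)
  rintro a ⟨ha, hl⟩
  refine ⟨ha, fun b hbm => ?_⟩
  have hl' : inner ℝ lam a = P.Phi i lam := hl
  exact hl'.trans_le (P.Phi_le_inner hb (subset_convexHull ℝ _ hbm))

theorem exists_bestResponse_of_mem_bestResponseSet (P : AggregativeProblem X E)
    {lam y : PiLp 2 E} {i : Fin N} (hy : y ∈ P.bestResponseSet lam i) :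
    ∃ x ∈ P.bestResponse lam i, P.scaledContribution i x = y := by
  obtain ⟨⟨x, rfl⟩, hmin⟩ := hy
  exact ⟨x, fun x' => hmin _ ⟨x', rfl⟩, rfl⟩

section Gradient

variable [∀ j, CompleteSpace (E j)]

theorem differentiableAt_cost_of_mem (P : AggregativeProblem X E) (hreg : P.Regular) (j : Fin M)
    {y : E j} (hy : y ∈ convexHull ℝ (P.meanRangeSet j)) : DifferentiableAt ℝ (P.f j) y := by
  obtain ⟨U, hU, hsub, hf⟩ := hreg.contDiff j
  exact (hf.contDiffAt (hU.mem_nhds (hsub hy))).differentiableAt one_ne_zero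

/-- The gradient of the rescaled cost, `(∇f_j(y_j / √L̃_j) / √L̃_j)_j`. It is the genuine gradient on
the convex hull of the aggregate set (`hasGradientAt_scaledCost`). -/
def scaledGradient (P : AggregativeProblem X E) (y : PiLp 2 E) : PiLp 2 E :=
  WithLp.toLp 2 fun j => (Real.sqrt (P.Lt j))⁻¹ • gradient (P.f j) (P.unscaledCoord j y)

theorem inner_scaledGradient (P : AggregativeProblem X E) (y v : PiLp 2 E) :
    inner ℝ (P.scaledGradient y) v =
      ∑ j, inner ℝ (gradient (P.f j) (P.unscaledCoord j y)) (P.unscaledCoord j v) := by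
  simp_rw [PiLp.inner_apply, unscaledCoord_apply, scaledGradient, real_inner_smul_left,
    real_inner_smul_right]
  rfl

theorem hasGradientAt_scaledCost (P : AggregativeProblem X E) (hLt : ∀ j, 0 < P.Lt j)
    (hreg : P.Regular) {y : PiLp 2 E} (hy : y ∈ convexHull ℝ P.aggregateSet) :
    HasGradientAt P.scaledCost (P.scaledGradient y) y := by
  have hsum := HasFDerivAt.fun_sum (u := Finset.univ) fun j _ =>
    ((P.differentiableAt_cost_of_mem hreg j
      (P.unscaledCoord_mem_convexHull_meanRangeSet hLt hy j)).hasGradientAt.hasFDerivAt).comp y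
      (P.unscaledCoord j).hasFDerivAt
  have hdual : InnerProductSpace.toDual ℝ (PiLp 2 E) (P.scaledGradient y) =
      ∑ j, (InnerProductSpace.toDual ℝ (E j) (gradient (P.f j) (P.unscaledCoord j y))).comp
        (P.unscaledCoord j) := by
    refine ContinuousLinearMap.ext fun v => ?_
    rw [InnerProductSpace.toDual_apply_apply, inner_scaledGradient, sum_apply]
    rfl
  rw [hasGradientAt_iff_hasFDerivAt, hdual]
  exact hsum

theorem scaledCost_le_add_inner_add_sq (P : AggregativeProblem X E) (hLt : ∀ j, 0 < P.Lt j)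
    (hreg : P.Regular) {y z : PiLp 2 E} (hy : y ∈ convexHull ℝ P.aggregateSet)
    (hz : z ∈ convexHull ℝ P.aggregateSet) :
    P.scaledCost z ≤
      P.scaledCost y + inner ℝ (P.scaledGradient y) (z - y) + 1 / 2 * ‖z - y‖ ^ 2 := by
  rw [inner_scaledGradient, PiLp.norm_sq_eq_of_L2, Finset.mul_sum, scaledCost_eq_sum,
    scaledCost_eq_sum, ← Finset.sum_add_distrib, ← Finset.sum_add_distrib]
  refine Finset.sum_le_sum fun j _ => ?_
  have h := le_add_inner_add_sq_of_lipschitzOnWith_gradient (convex_convexHull ℝ _)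
    (fun x hx => P.differentiableAt_cost_of_mem hreg j hx) (hreg.lipschitz_gradient j)
    (P.unscaledCoord_mem_convexHull_meanRangeSet hLt hy j)
    (P.unscaledCoord_mem_convexHull_meanRangeSet hLt hz j)
  have hpos : (0 : ℝ) < P.Lt j := hLt j
  have hnorm : (P.Lt j : ℝ) / 2 * ‖P.unscaledCoord j (z - y)‖ ^ 2 = 1 / 2 * ‖(z - y) j‖ ^ 2 := by
    rw [unscaledCoord_apply, norm_smul, mul_pow, norm_inv, Real.norm_of_nonneg (Real.sqrt_nonneg _),
      inv_pow, Real.sq_sqrt hpos.le]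
    field_simp
  rw [← map_sub, hnorm] at h
  exact h

theorem exists_forall_scaledCost_le (P : AggregativeProblem X E) [∀ i, Nonempty (X i)]
    (hLt : ∀ j, 0 < P.Lt j) (hreg : P.Regular) (hconv : P.ConvexCost)
    (hclosed : IsClosed (convexHull ℝ P.aggregateSet)) :
    ∃ y ∈ convexHull ℝ P.aggregateSet, ∀ z ∈ convexHull ℝ P.aggregateSet,
      P.scaledCost y ≤ P.scaledCost z := by
  have hcvx := P.scaledCost_convexOn hconv.convex
  have hbd := P.convexHull_aggregateSet_isBounded hreg.bounded
  obtain ⟨y₀, hy₀⟩ : (convexHull ℝ P.aggregateSet).Nonempty := P.aggregateSet_nonempty.convexHull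
  refine exists_forall_le_of_convexOn_of_lsc ⟨y₀, hy₀⟩ hclosed (convex_convexHull ℝ _) hbd
    (P.scaledCost_lowerSemicontinuous hconv.lsc) hcvx ?_
  -- Boundedness below comes from the affine minorant of the convex cost at some `y₀`.
  obtain ⟨R, hR⟩ := hbd.exists_norm_le
  refine ⟨P.scaledCost y₀ - ‖P.scaledGradient y₀‖ * (R + R), ?_⟩
  rintro _ ⟨z, hz, rfl⟩
  have h1 := hcvx.add_inner_le_of_hasGradientAt (P.hasGradientAt_scaledCost hLt hreg hy₀) z
  have h2 := (abs_le.1 (abs_real_inner_le_norm (P.scaledGradient y₀) (z - y₀))).1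
  have h3 := mul_le_mul_of_nonneg_left ((norm_sub_le z y₀).trans (add_le_add (hR z hz) (hR y₀ hy₀)))
    (norm_nonneg (P.scaledGradient y₀))
  linarith

/-- A dual solution is the gradient of the rescaled cost at any minimizer `y` over the convexified
aggregate set. The second part of the conclusion, whose converse inequality always holds, says that
`y` minimizes `⟪lam, ·⟫` on that set. -/
theorem IsDualSolution.eq_scaledGradient {P : AggregativeProblem X E} [∀ i, Nonempty (X i)]
    {lam : PiLp 2 E} (hlam : P.IsDualSolution lam) (hN : 0 < N) (hLt : ∀ j, 0 < P.Lt j)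
    (hreg : P.Regular) (hconv : P.ConvexCost) {y : PiLp 2 E}
    (hy : y ∈ convexHull ℝ P.aggregateSet)
    (hmin : ∀ z ∈ convexHull ℝ P.aggregateSet, P.scaledCost y ≤ P.scaledCost z) :
    lam = P.scaledGradient y ∧ inner ℝ lam y ≤ (N : ℝ)⁻¹ * ∑ i, P.Phi i lam := by
  have hgrad := P.hasGradientAt_scaledCost hLt hreg hy
  have hlow : P.scaledCost y ≤ -(inner ℝ (P.scaledGradient y) y - P.scaledCost y)
      + (N : ℝ)⁻¹ * ∑ i, P.Phi i (P.scaledGradient y) := by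
    have := P.le_smul_sum_Phi hN (lam := P.scaledGradient y)
      (c := inner ℝ (P.scaledGradient y) y) fun z hz => by
        have := hgrad.inner_sub_nonneg_of_forall_le (convex_convexHull ℝ _) hy hmin hz
        rw [inner_sub_right] at this
        linarith
    linarith
  have hdual : ∀ z, P.scaledCost y ≤
      -(inner ℝ lam z - P.scaledCost z) + (N : ℝ)⁻¹ * ∑ i, P.Phi i lam := fun z => by
    have h1 := P.le_dualObjective (lam := P.scaledGradient y)
      (c := inner ℝ (P.scaledGradient y) y - P.scaledCost y) fun z => by
        have := (P.scaledCost_convexOn hconv.convex).add_inner_le_of_hasGradientAt hgrad z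
        rw [inner_sub_right] at this
        linarith
    exact hlow.trans (EReal.coe_le_coe_iff.1
      (h1.trans ((hlam _).trans (P.dualObjective_le lam z))))
  have hPhi : (N : ℝ)⁻¹ * ∑ i, P.Phi i lam ≤ inner ℝ lam y := by
    obtain ⟨z, hz, rfl⟩ := P.exists_eq_smul_sum_of_mem_convexHull_aggregateSet hy
    rw [real_inner_smul_right, inner_sum]
    gcongr with i
    exact P.Phi_le_inner (P.agentSet_isBounded hreg.bounded i) (hz i)
  refine ⟨hgrad.eq_of_forall_add_inner_le fun z => ?_, ?_⟩
  · have := hdual z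
    rw [inner_sub_right]
    linarith
  · have := hdual y
    linarith

/-- Rounding of the relaxed minimizer `y` to a profile of best responses. -/
theorem exists_decFeasible_J_le (P : AggregativeProblem X E) [∀ i, Nonempty (X i)]
    {lam : PiLp 2 E} (hlam : P.IsDualSolution lam) (hN : 0 < N) (hLt : ∀ j, 0 < P.Lt j)
    (hreg : P.Regular) (hconv : P.ConvexCost) {y : PiLp 2 E}
    (hy : y ∈ convexHull ℝ P.aggregateSet)
    (hmin : ∀ z ∈ convexHull ℝ P.aggregateSet, P.scaledCost y ≤ P.scaledCost z)
    {ε : ℝ} (hε : 0 < ε) :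
    ∃ x ∈ P.decFeasible lam, P.J x ≤ P.scaledCost y +
      1 / (2 * (N : ℝ) ^ 2) * (P.maxBestResponseNonconvexity lam + ε) := by
  have hN' : (0 : ℝ) < N := Nat.cast_pos.2 hN
  have hb := P.agentSet_isBounded hreg.bounded
  obtain ⟨hgrad, hPhi⟩ := hlam.eq_scaledGradient hN hLt hreg hconv hy hmin
  obtain ⟨z, hz, hyz⟩ := P.exists_eq_smul_sum_of_mem_convexHull_aggregateSet hy
  have hle : ∀ i ∈ Finset.univ, P.Phi i lam ≤ inner ℝ lam (z i) :=
    fun i _ => P.Phi_le_inner (hb i) (hz i)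
  have heq : ∑ i, P.Phi i lam = ∑ i, inner ℝ lam (z i) := by
    refine le_antisymm (Finset.sum_le_sum hle) ?_
    rw [hyz, real_inner_smul_right, inner_sum] at hPhi
    exact le_of_mul_le_mul_left hPhi (inv_pos.2 hN')
  have hz' : ∀ i, z i ∈ convexHull ℝ (P.bestResponseSet lam i) := fun i =>
    P.mem_convexHull_bestResponseSet (hb i) (hz i)
      ((Finset.sum_eq_sum_iff_of_le hle).1 heq i (Finset.mem_univ i)).ge
  obtain ⟨w, Q, hw, hQ, hwz⟩ := exists_norm_sum_sub_sq_le_nonconvexityMeasure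
    (P.bestResponseSet_isBounded hreg.bounded lam) hz' hε
  choose x hx hxw using fun i => P.exists_bestResponse_of_mem_bestResponseSet (hw i)
  refine ⟨x, hx, ?_⟩
  have hmax : ∑ i ∈ Q, nonconvexityMeasure (P.bestResponseSet lam i) ^ 2
      ≤ P.maxBestResponseNonconvexity lam := by
    rw [Fintype.card_fin] at hQ
    exact le_ciSup (f := fun Q : {Q : Finset (Fin N) // Q.card = P.dimMin} =>
      ∑ i ∈ Q.1, nonconvexityMeasure (P.bestResponseSet lam i) ^ 2)
      (Set.finite_range _).bddAbove ⟨Q, hQ⟩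
  have hdesc := P.scaledCost_le_add_inner_add_sq hLt hreg hy
    (P.smul_sum_mem_convexHull_aggregateSet fun i => subset_convexHull ℝ _ (hw i).1)
  have hinner : inner ℝ (P.scaledGradient y) ((N : ℝ)⁻¹ • ∑ i, w i - y) = 0 := by
    rw [← hgrad, hyz, ← smul_sub, real_inner_smul_right, inner_sub_right, inner_sum, inner_sum,
      ← heq, Finset.sum_congr rfl fun i _ =>
        P.inner_eq_Phi_of_mem_bestResponseSet (hb i) (hw i), sub_self, mul_zero]
  rw [P.J_eq_scaledCost hLt]
  simp_rw [hxw]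
  refine hdesc.trans ?_
  rw [hinner, add_zero]
  refine add_le_add_right ?_ _
  rw [hyz, ← smul_sub, norm_smul, mul_pow, norm_inv, Real.norm_of_nonneg hN'.le]
  calc 1 / 2 * ((N : ℝ)⁻¹ ^ 2 * ‖∑ i, w i - ∑ i, z i‖ ^ 2)
      = 1 / (2 * (N : ℝ) ^ 2) * ‖∑ i, w i - ∑ i, z i‖ ^ 2 := by field_simp
    _ ≤ _ := by
        gcongr
        linarith

end Gradient

end AggregativeProblem

end

theorem proposition4p8 {N M : ℕ} (hN : 0 < N) {X : Fin N → Type*} {E : Fin M → Type*}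
    [∀ i, Nonempty (X i)]
    [∀ j, NormedAddCommGroup (E j)] [∀ j, InnerProductSpace ℝ (E j)]
    [∀ j, CompleteSpace (E j)] [∀ j, TopologicalSpace.SeparableSpace (E j)]
    (P : AggregativeProblem X E) (hLt : ∀ j, 0 < P.Lt j)
    (hreg : P.Regular) (hconv : P.ConvexCost) (horacle : P.OracleSolvable)
    (hclosed : IsClosed (convexHull ℝ P.aggregateSet))
    (lam : PiLp 2 E) (hlam : P.IsDualSolution lam) :
    -- the three infima are genuine (finite) infima
    IsGLB (Set.range P.J) P.primalValue ∧
    IsGLB (Set.range P.Jrand) P.randomizedValue ∧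
    IsGLB (P.J '' P.decFeasible lam) (P.decValue lam) ∧
    -- the announced estimate
    P.priceOfDecentralization lam ≤ P.decValue lam - P.randomizedValue ∧
    P.decValue lam - P.randomizedValue ≤
      1 / (2 * (N : ℝ) ^ 2) * P.maxBestResponseNonconvexity lam := by
  obtain ⟨y, hy, hmin⟩ := P.exists_forall_scaledCost_le hLt hreg hconv hclosed
  have hfeas := fun {ε : ℝ} (hε : 0 < ε) =>
    P.exists_decFeasible_J_le hlam hN hLt hreg hconv hy hmin hε
  have hrand : ∀ v ∈ Set.range P.Jrand, P.scaledCost y ≤ v := by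
    rintro _ ⟨μ, rfl⟩
    rw [P.Jrand_eq_scaledCost hLt]
    exact hmin _ (P.smul_sum_mem_convexHull_aggregateSet
      fun i => FinProb.expect_mem_convexHull (μ i) _)
  have hJ : Set.range P.J ⊆ Set.range P.Jrand := by
    rintro _ ⟨x, rfl⟩
    exact ⟨_, (P.J_eq_Jrand_single x).symm⟩
  have hdec : P.J '' P.decFeasible lam ⊆ Set.range P.J := Set.image_subset_range _ _
  obtain ⟨x₀, hx₀, -⟩ := hfeas one_pos
  have hbRand : BddBelow (Set.range P.Jrand) := ⟨_, hrand⟩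
  have hneJ : (Set.range P.J).Nonempty := ⟨_, x₀, rfl⟩
  have hglbJ := Real.isGLB_sInf hneJ (hbRand.mono hJ)
  have hglbRand := Real.isGLB_sInf (hneJ.mono hJ) hbRand
  have hglbDec := Real.isGLB_sInf (Set.Nonempty.image P.J ⟨x₀, hx₀⟩) ((hbRand.mono hJ).mono hdec)
  refine ⟨hglbJ, hglbRand, hglbDec, sub_le_sub_left (hglbJ.mono hglbRand hJ) _, ?_⟩
  have hle : P.scaledCost y ≤ P.randomizedValue := hglbRand.2 hrand
  have hdecle : P.decValue lam ≤ P.scaledCost y +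
      1 / (2 * (N : ℝ) ^ 2) * P.maxBestResponseNonconvexity lam := by
    refine le_of_forall_pos_le_add fun ε hε => ?_
    have hN' : (0 : ℝ) < N := Nat.cast_pos.2 hN
    obtain ⟨x, hx, hxle⟩ := hfeas (show 0 < 2 * (N : ℝ) ^ 2 * ε by positivity)
    refine (hglbDec.1 ⟨x, hx, rfl⟩).trans (hxle.trans_eq ?_)
    field_simp
    ring
  linarith
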